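/- Algebras are considered in the signature $\langle \vee,\wedge,\cdot,\rightarrow,1\rangle$. A commutative integral residuated lattice is an algebra $\langle A,\vee,\wedge,\cdot,\rightarrow,1\rangle$ such that $\langle A,\vee,\wedge\rangle$ is a lattice with largest element $1$, $\langle A,\cdot,1\rangle$ is a commutative monoid, and $a\cdot b\le c$ if and only if $a\le b\rightarrow c$ for all $a,b,c\in A$; an $\mathsf{FL}_{ew}$-algebra is such an algebra with an additional constant $0$ that is its least element. A basic hoop is a $0$-free subreduct (a subalgebra of the $\langle \vee,\wedge,\cdot,\rightarrow,1\rangle$-reduct, up to isomorphism) of an $\mathsf{FL}_{ew}$-algebra satisfying $(x\rightarrow y)\vee(y\rightarrow x)\approx 1$ and $x(x\rightarrow y)\approx y(y\rightarrow x)$. A Wajsberg hoop is a basic hoop satisfying $(x\rightarrow y)\rightarrow y\approx (y\rightarrow x)\rightarrow x$. A class of algebras is a variety if it is closed under homomorphic images, subalgebras and direct products, and a quasivariety if it is closed under isomorphic copies, subalgebras, direct products and ultraproducts. (Direct products of the empty family are allowed.) For a class $\mathsf K$ of algebras, $\mathbf H(\mathsf K)$ is the class of all homomorphic images of members of $\mathsf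 K$. A class is locally finite if every finitely generated subalgebra of each of its members is finite. A quasivariety $\mathsf Q$ is primitive if every quasivariety $\mathsf Q'\subseteq\mathsf Q$ satisfies $\mathsf Q'=\mathbf H(\mathsf Q')\cap\mathsf Q$. **Theorem.** Let $\mathsf Q$ be a locally finite quasivariety all of whose members are Wajsberg hoops. Then $\mathsf Q$ is a variety, and $\mathsf Q$ is primitive. -/

import Mathlib

universe u

open FirstOrder FirstOrder.Language CategoryTheory

/-! ### Classes of algebras

An algebra of type `L` is an `L`-structure; the languages `L` used here have only function symbols. -/

namespace UnivAlg

variable {L : FirstOrder.Language.{0, 0}}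

/-- The operations of a direct product, defined componentwise. -/
abbrev piStructure {ι : Type u} (A : ι → Bundled.{u} L.Structure) :
    L.Structure (∀ i, A i) where
  funMap f x := fun i => Structure.funMap f (fun k => x k i)
  RelMap r x := ∀ i, Structure.RelMap r (fun k => x k i)

/-- The direct product of a family of algebras (the empty family is allowed and gives a
one-element algebra). -/
def product {ι : Type u} (A : ι → Bundled.{u} L.Structure) : Bundled.{u} L.Structure :=
  ⟨∀ i, A i, piStructure A⟩

/-- The ultraproduct of a family of algebras. -/
def ultraproduct {ι : Type u} (U : Ultrafilter ι) (A : ι → Bundled.{u} L.Structure) :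
    Bundled.{u} L.Structure :=
  ⟨(U : Filter ι).Product (fun i => A i), inferInstance⟩

/-- A subalgebra, as an algebra. -/
def subalgebra (A : Bundled.{u} L.Structure) (S : L.Substructure A) : Bundled.{u} L.Structure :=
  ⟨S, inferInstance⟩

/-- `HH K`: the class of all homomorphic images of members of `K`. -/
def HH (K : Set (Bundled.{u} L.Structure)) : Set (Bundled.{u} L.Structure) :=
  {B | ∃ A ∈ K, ∃ f : A →[L] B, Function.Surjective f}

def ClosedUnderIso (K : Set (Bundled.{u} L.Structure)) : Prop :=
  ∀ A ∈ K, ∀ B : Bundled.{u} L.Structure, Nonempty (A ≃[L] B) → B ∈ K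

def ClosedUnderSubalgebras (K : Set (Bundled.{u} L.Structure)) : Prop :=
  ∀ A ∈ K, ∀ S : L.Substructure A, subalgebra A S ∈ K

def ClosedUnderProducts (K : Set (Bundled.{u} L.Structure)) : Prop :=
  ∀ (ι : Type u) (A : ι → Bundled.{u} L.Structure), (∀ i, A i ∈ K) → product A ∈ K

def ClosedUnderUltraproducts (K : Set (Bundled.{u} L.Structure)) : Prop :=
  ∀ (ι : Type u) (U : Ultrafilter ι) (A : ι → Bundled.{u} L.Structure),
    (∀ i, A i ∈ K) → ultraproduct U A ∈ K

/-- A variety: a class of algebras closed under homomorphic images, subalgebras and direct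
products. -/
structure IsVariety (K : Set (Bundled.{u} L.Structure)) : Prop where
  homImages : HH K ⊆ K
  subalgebras : ClosedUnderSubalgebras K
  products : ClosedUnderProducts K

/-- A quasivariety: a class of algebras closed under isomorphic copies, subalgebras, direct
products and ultraproducts. -/
structure IsQuasivariety (K : Set (Bundled.{u} L.Structure)) : Prop where
  iso : ClosedUnderIso K
  subalgebras : ClosedUnderSubalgebras K
  products : ClosedUnderProducts K
  ultraproducts : ClosedUnderUltraproducts K

/-- `K` is locally finite: finitely generated subalgebras of members of `K` are finite. -/
def IsLocallyFinite (K : Set (Bundled.{u} L.Structure)) : Prop :=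
  ∀ A ∈ K, ∀ S : L.Substructure A, S.FG → Finite S

/-- `Q'` is equational in `Q`. -/
def IsEquationalIn (Q' Q : Set (Bundled.{u} L.Structure)) : Prop :=
  Q' = HH Q' ∩ Q

/-- A quasivariety `Q` is primitive if every subquasivariety of `Q` is equational in `Q`. -/
structure IsPrimitive (Q : Set (Bundled.{u} L.Structure)) : Prop where
  quasivariety : IsQuasivariety Q
  equational : ∀ Q' : Set (Bundled.{u} L.Structure),
    IsQuasivariety Q' → Q' ⊆ Q → IsEquationalIn Q' Q

end UnivAlg

/-! ### Hoops -/

namespace Hoop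

/-- The operation symbols `∨, ∧, ·, →` (binary) and `1` (a constant). -/
inductive Op : ℕ → Type
  | one : Op 0
  | sup : Op 2
  | inf : Op 2
  | mul : Op 2
  | imp : Op 2

/-- The language of commutative integral residuated lattices. -/
abbrev lang : FirstOrder.Language.{0, 0} := ⟨Op, fun _ => Empty⟩

section

variable {A : Type u} [lang.Structure A]

variable (A) in
def one : A := Structure.funMap (L := lang) Op.one ![]

def sup (x y : A) : A := Structure.funMap (L := lang) Op.sup ![x, y]

def inf (x y : A) : A := Structure.funMap (L := lang) Op.inf ![x, y]

def mul (x y : A) : A := Structure.funMap (L := lang) Op.mul ![x, y]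

def imp (x y : A) : A := Structure.funMap (L := lang) Op.imp ![x, y]

/-- The lattice order. -/
def le (x y : A) : Prop := inf x y = x

end

/-- `⟨A, ∨, ∧, ·, →, 1⟩` is a commutative integral residuated lattice. -/
structure IsCIRL (A : Type u) [lang.Structure A] : Prop where
  sup_comm : ∀ x y : A, sup x y = sup y x
  sup_assoc : ∀ x y z : A, sup (sup x y) z = sup x (sup y z)
  inf_comm : ∀ x y : A, inf x y = inf y x
  inf_assoc : ∀ x y z : A, inf (inf x y) z = inf x (inf y z)
  sup_inf_self : ∀ x y : A, sup x (inf x y) = x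
  inf_sup_self : ∀ x y : A, inf x (sup x y) = x
  le_one : ∀ x : A, le x (one A)
  mul_comm : ∀ x y : A, mul x y = mul y x
  mul_assoc : ∀ x y z : A, mul (mul x y) z = mul x (mul y z)
  one_mul : ∀ x : A, mul (one A) x = x
  residuation : ∀ a b c : A, le (mul a b) c ↔ le a (imp b c)

/-- `⟨A, ∨, ∧, ·, →, z, 1⟩` is an `FL_ew`-algebra: a commutative integral residuated lattice with
the least element `z` as an additional constant. -/
structure IsFLew (A : Type u) [lang.Structure A] (z : A) : Prop where
  cirl : IsCIRL A
  zero_le : ∀ x : A, le z x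

/-- The prelinearity equation `(x → y) ∨ (y → x) ≈ 1`. -/
def Prelinear (A : Type u) [lang.Structure A] : Prop :=
  ∀ x y : A, sup (imp x y) (imp y x) = one A

/-- The divisibility equation `x (x → y) ≈ y (y → x)`. -/
def Divisible (A : Type u) [lang.Structure A] : Prop :=
  ∀ x y : A, mul x (imp x y) = mul y (imp y x)

/-- A basic hoop: a zero-free subreduct of a divisible and prelinear `FL_ew`-algebra, i.e. an
algebra that embeds, with respect to the operations `∨, ∧, ·, →, 1`, in such an `FL_ew`-algebra. -/
def IsBasicHoop (A : Type u) [lang.Structure A] : Prop :=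
  ∃ B : Bundled.{u} lang.Structure, (∃ z : B, IsFLew B z) ∧ Divisible B ∧ Prelinear B ∧
    Nonempty (A ↪[lang] B)

/-- A Wajsberg hoop: a basic hoop satisfying Tanaka's equation
`(x → y) → y ≈ (y → x) → x`. -/
structure IsWajsbergHoop (A : Type u) [lang.Structure A] : Prop where
  basic : IsBasicHoop A
  tanaka : ∀ x y : A, imp (imp x y) y = imp (imp y x) x

/-- The class `WH` of all Wajsberg hoops. -/
def WH : Set (Bundled.{u} lang.Structure) := {A | IsWajsbergHoop A}

end Hoop

/-!
A locally finite quasivariety `Q` of Wajsberg hoops is closed under homomorphic images because a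
homomorphic image of a *finite* Wajsberg hoop `A` is isomorphic to a subalgebra of `A`.

Indeed, let `f : A → B` be onto. As `A` is finite, the filter `f⁻¹(1)` has a least element `e`,
which is idempotent. Tanaka's equation gives `e ∨ (e → z) = 1` for idempotent `e`; it is used here
in the form `IsCIRL.le_of_mul_idem_le`, and it makes the map `x ↦ (e → x)` an endomorphism of `A`
(for `→`, `∧` and `1` idempotence alone suffices). This endomorphism identifies exactly the pairs
identified by `f`, so it factors through an embedding `B → A`
(`Hoop.exists_embedding_of_surjective`).

For arbitrary `A ∈ Q` and `f : A → B` onto, a finitely generated subalgebra of `B` is the image of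
a finitely generated, hence finite, subalgebra of `A`, so it belongs to `Q`. An algebra embeds into
an ultraproduct of its finitely generated subalgebras, so `B ∈ Q`
(`UnivAlg.IsQuasivariety.mem_of_forall_fg`).

Primitivity follows at once: a subquasivariety of `Q` is again locally finite, hence a variety, so
it contains all its homomorphic images.
-/

/-! ### Quasivarieties and finitely generated subalgebras -/

namespace UnivAlg

variable {L : FirstOrder.Language.{0, 0}}

theorem IsQuasivariety.mem_of_embedding {Q : Set (Bundled.{u} L.Structure)}
    (hQ : IsQuasivariety Q) {A B : Bundled.{u} L.Structure} (hA : A ∈ Q) (g : B ↪[L] A) :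
    B ∈ Q :=
  hQ.iso _ (hQ.subalgebras A hA g.toHom.range) B ⟨g.equivRange.symm⟩

section Ultraproduct

variable (B : Bundled.{u} L.Structure)

/-- The element `b`, if it lies in the subalgebra generated by `t`; otherwise a default value. -/
noncomputable def truncate (d : ∀ t : Finset B, Substructure.closure L (t : Set B)) (b : B)
    (t : Finset B) : Substructure.closure L (t : Set B) :=
  open Classical in
  if h : b ∈ Substructure.closure L (t : Set B) then ⟨b, h⟩ else d t

variable {B}

theorem coe_truncate (d : ∀ t : Finset B, Substructure.closure L (t : Set B)) {b : B}
    {t : Finset B} (h : b ∈ t) : (truncate B d b t : B) = b := by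
  have h' : b ∈ Substructure.closure L (t : Set B) := Substructure.subset_closure h
  simp [truncate, h']

/-- An algebra embeds into an ultraproduct of its finitely generated subalgebras. The default
values `d` only ensure that these subalgebras are nonempty. -/
theorem exists_embedding_ultraproduct_closure [L.IsAlgebraic]
    (d : ∀ t : Finset B, Substructure.closure L (t : Set B)) :
    ∃ U : Ultrafilter (Finset B), Nonempty
      (B ↪[L] ultraproduct U fun t => subalgebra B (Substructure.closure L (t : Set B))) := by
  classical
  let U : Ultrafilter (Finset B) := Ultrafilter.of Filter.atTop
  have hU : ∀ b : B, ∀ᶠ t in (U : Filter (Finset B)), b ∈ t := fun b =>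
    (Ultrafilter.of_le Filter.atTop)
      ((Filter.eventually_ge_atTop {b}).mono fun t ht => ht (Finset.mem_singleton_self b))
  let F : B → ultraproduct U fun t => subalgebra B (Substructure.closure L (t : Set B)) :=
    fun b => Quotient.mk _ (truncate B d b)
  refine ⟨U, ⟨⟨⟨F, fun x y hxy => ?_⟩, fun {n} f x => ?_, fun r => isEmptyElim r⟩⟩⟩
  · have h : ∀ᶠ t in (U : Filter (Finset B)), truncate B d x t = truncate B d y t :=
      Quotient.exact hxy
    obtain ⟨t, ht, hx, hy⟩ := (h.and ((hU x).and (hU y))).exists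
    rw [← coe_truncate d hx, ← coe_truncate d hy, ht]
  · refine Eq.trans ?_ (FirstOrder.Language.Ultraproduct.funMap_cast
      (M := fun t : Finset B => Substructure.closure L (t : Set B)) (u := U) f
      fun i => truncate B d (x i)).symm
    refine Quotient.sound ?_
    have h : ∀ᶠ t in (U : Filter (Finset B)), ∀ i, x i ∈ t :=
      Filter.eventually_all.2 fun i => hU (x i)
    filter_upwards [h, hU (Structure.funMap f x)] with t ht hf
    refine Subtype.ext ((coe_truncate d hf).trans ?_)
    change Structure.funMap f x = Structure.funMap f fun i => (truncate B d (x i) t : B)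
    exact congrArg _ (funext fun i => (coe_truncate d (ht i)).symm)

end Ultraproduct

theorem IsQuasivariety.mem_of_forall_fg [L.IsAlgebraic] {Q : Set (Bundled.{u} L.Structure)}
    (hQ : IsQuasivariety Q) {B : Bundled.{u} L.Structure} (c : L.Constants)
    (h : ∀ T : L.Substructure B, T.FG → subalgebra B T ∈ Q) : B ∈ Q := by
  obtain ⟨U, ⟨g⟩⟩ := exists_embedding_ultraproduct_closure (B := B)
    fun t => ⟨_, Substructure.constants_mem c⟩
  exact hQ.mem_of_embedding (hQ.ultraproducts _ U _ fun t => h _ (Substructure.fg_closure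
    t.finite_toSet)) g

/-- A finitely generated subalgebra of a homomorphic image of `A` is a homomorphic image of a
finitely generated subalgebra of `A`. -/
theorem exists_fg_surjective {A B : Bundled.{u} L.Structure} (f : A →[L] B)
    (hf : Function.Surjective f) {T : L.Substructure B} (hT : T.FG) :
    ∃ S : L.Substructure A, S.FG ∧
      ∃ g : subalgebra A S →[L] subalgebra B T, Function.Surjective g := by
  classical
  obtain ⟨t, rfl⟩ := hT
  have himg : f '' (Function.surjInv hf '' (t : Set B)) = t := by
    simp [Set.image_image, Function.surjInv_eq hf]
  have hmap : (Substructure.closure L (Function.surjInv hf '' (t : Set B))).map f =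
      Substructure.closure L (t : Set B) := by
    rw [← Substructure.closure_image, himg]
  refine ⟨_, Substructure.fg_closure (t.finite_toSet.image (Function.surjInv hf)),
    (f.comp (Substructure.subtype _).toHom).codRestrict _ fun x => ?_, ?_⟩
  · rw [← hmap]
    exact ⟨x, x.2, rfl⟩
  · rintro ⟨y, hy⟩
    rw [← hmap] at hy
    obtain ⟨x, hx, rfl⟩ := hy
    exact ⟨⟨x, hx⟩, Subtype.ext rfl⟩

end UnivAlg

/-! ### Commutative integral residuated lattices -/

namespace Hoop

section Hom

variable {A B : Type u} [lang.Structure A] [lang.Structure B] (f : A →[lang] B)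

theorem map_one : f (one A) = one B :=
  (f.map_fun Op.one _).trans (congrArg _ (funext fun i => i.elim0))

theorem map_sup (x y : A) : f (sup x y) = sup (f x) (f y) :=
  (f.map_fun Op.sup _).trans (congrArg _ (funext fun i => by fin_cases i <;> rfl))

theorem map_inf (x y : A) : f (inf x y) = inf (f x) (f y) :=
  (f.map_fun Op.inf _).trans (congrArg _ (funext fun i => by fin_cases i <;> rfl))

theorem map_mul (x y : A) : f (mul x y) = mul (f x) (f y) :=
  (f.map_fun Op.mul _).trans (congrArg _ (funext fun i => by fin_cases i <;> rfl))

theorem map_imp (x y : A) : f (imp x y) = imp (f x) (f y) :=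
  (f.map_fun Op.imp _).trans (congrArg _ (funext fun i => by fin_cases i <;> rfl))

theorem le_iff_of_injective (hf : Function.Injective f) {x y : A} : le (f x) (f y) ↔ le x y := by
  rw [le, ← map_inf, hf.eq_iff, le]

theorem IsCIRL.of_injective (hB : IsCIRL B) (hf : Function.Injective f) : IsCIRL A where
  sup_comm x y := hf (by simp only [map_sup, hB.sup_comm (f x)])
  sup_assoc x y z := hf (by simp only [map_sup, hB.sup_assoc])
  inf_comm x y := hf (by simp only [map_inf, hB.inf_comm (f x)])
  inf_assoc x y z := hf (by simp only [map_inf, hB.inf_assoc])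
  sup_inf_self x y := hf (by simp only [map_sup, map_inf, hB.sup_inf_self])
  inf_sup_self x y := hf (by simp only [map_sup, map_inf, hB.inf_sup_self])
  le_one x := (le_iff_of_injective f hf).1 (by rw [map_one]; exact hB.le_one _)
  mul_comm x y := hf (by simp only [map_mul, hB.mul_comm (f x)])
  mul_assoc x y z := hf (by simp only [map_mul, hB.mul_assoc])
  one_mul x := hf (by simp only [map_mul, map_one, hB.one_mul])
  residuation a b c := by
    rw [← le_iff_of_injective f hf, ← le_iff_of_injective f hf, map_mul, map_imp, hB.residuation]

end Hom

theorem IsWajsbergHoop.isCIRL {A : Type u} [lang.Structure A] (hA : IsWajsbergHoop A) :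
    IsCIRL A := by
  obtain ⟨B, ⟨z, hB⟩, -, -, ⟨g⟩⟩ := hA.basic
  exact hB.cirl.of_injective g.toHom g.injective

namespace IsCIRL

variable {A : Type u} [lang.Structure A]

theorem inf_self (hA : IsCIRL A) (x : A) : inf x x = x := by
  conv_lhs => rw [← hA.sup_inf_self x x]
  conv_lhs => arg 1; rw [hA.sup_inf_self]
  exact hA.inf_sup_self x _

theorem le_refl (hA : IsCIRL A) (x : A) : le x x := hA.inf_self x

theorem le_antisymm (hA : IsCIRL A) {x y : A} (h : le x y) (h' : le y x) : x = y := by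
  rw [← h, hA.inf_comm, h']

theorem le_trans (hA : IsCIRL A) {x y z : A} (h : le x y) (h' : le y z) : le x z := by
  rw [le, ← h, hA.inf_assoc, h']

theorem inf_le_left (hA : IsCIRL A) (x y : A) : le (inf x y) x := by
  rw [le, hA.inf_comm, ← hA.inf_assoc, hA.inf_self]

theorem inf_le_right (hA : IsCIRL A) (x y : A) : le (inf x y) y := by
  rw [hA.inf_comm]; exact hA.inf_le_left y x

theorem le_inf (hA : IsCIRL A) {x y z : A} (hx : le z x) (hy : le z y) : le z (inf x y) := by
  rw [le, ← hA.inf_assoc, hx, hy]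

theorem le_sup_left (hA : IsCIRL A) (x y : A) : le x (sup x y) := hA.inf_sup_self x y

theorem le_sup_right (hA : IsCIRL A) (x y : A) : le y (sup x y) := by
  rw [hA.sup_comm]; exact hA.le_sup_left y x

theorem sup_eq_right (hA : IsCIRL A) {x y : A} (h : le x y) : sup x y = y := by
  rw [← h, hA.inf_comm, hA.sup_comm, hA.sup_inf_self]

theorem sup_le (hA : IsCIRL A) {x y z : A} (hx : le x z) (hy : le y z) : le (sup x y) z := by
  have h : sup (sup x y) z = z := by rw [hA.sup_assoc, hA.sup_eq_right hy, hA.sup_eq_right hx]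
  rw [← h]
  exact hA.le_sup_left _ _

theorem mul_one (hA : IsCIRL A) (x : A) : mul x (one A) = x := by
  rw [hA.mul_comm, hA.one_mul]

theorem mul_le_mul_right (hA : IsCIRL A) {x y : A} (h : le x y) (z : A) :
    le (mul x z) (mul y z) :=
  (hA.residuation x z _).2 (hA.le_trans h ((hA.residuation y z _).1 (hA.le_refl _)))

theorem mul_le_mul_left (hA : IsCIRL A) {x y : A} (h : le x y) (z : A) :
    le (mul z x) (mul z y) := by
  rw [hA.mul_comm z, hA.mul_comm z]; exact hA.mul_le_mul_right h z

theorem mul_le_left (hA : IsCIRL A) (x y : A) : le (mul x y) x := by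
  have h := hA.mul_le_mul_left (hA.le_one y) x
  rwa [hA.mul_one] at h

theorem mul_le_right (hA : IsCIRL A) (x y : A) : le (mul x y) y := by
  rw [hA.mul_comm]; exact hA.mul_le_left y x

theorem imp_mul_le (hA : IsCIRL A) (x y : A) : le (mul (imp x y) x) y :=
  (hA.residuation _ _ _).2 (hA.le_refl _)

theorem le_imp (hA : IsCIRL A) (x y : A) : le y (imp x y) :=
  (hA.residuation _ _ _).1 (hA.mul_le_left y x)

theorem imp_eq_one_iff (hA : IsCIRL A) {x y : A} : imp x y = one A ↔ le x y := by
  rw [← hA.one_mul x, hA.residuation, hA.one_mul]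
  exact ⟨fun h => h ▸ hA.le_refl _, fun h => hA.le_antisymm (hA.le_one _) h⟩

theorem one_imp (hA : IsCIRL A) (x : A) : imp (one A) x = x := by
  refine hA.le_antisymm ?_ (hA.le_imp _ _)
  have h := hA.imp_mul_le (one A) x
  rwa [hA.mul_one] at h

theorem imp_le_imp_left (hA : IsCIRL A) {x y : A} (h : le x y) (z : A) :
    le (imp z x) (imp z y) :=
  (hA.residuation _ _ _).1 (hA.le_trans (hA.imp_mul_le z x) h)

theorem imp_le_imp_right (hA : IsCIRL A) {x y : A} (h : le x y) (z : A) :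
    le (imp y z) (imp x z) :=
  (hA.residuation _ _ _).1 (hA.le_trans (hA.mul_le_mul_left h _) (hA.imp_mul_le y z))

/-! ### The endomorphism given by an idempotent -/

theorem imp_idem_imp (hA : IsCIRL A) {e : A} (he : mul e e = e) (z : A) :
    imp e (imp e z) = imp e z := by
  refine hA.le_antisymm ((hA.residuation _ _ _).1 ?_) (hA.le_imp _ _)
  have h := hA.le_trans (hA.mul_le_mul_right (hA.imp_mul_le e (imp e z)) e) (hA.imp_mul_le e z)
  rwa [hA.mul_assoc, he] at h

/-- Reasoning by cases along `e ∨ (e → z) = 1`, which Tanaka's equation gives for idempotent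
`e`. -/
theorem le_of_mul_idem_le (hA : IsCIRL A)
    (hT : ∀ x y : A, imp (imp x y) y = imp (imp y x) x) {e : A} (he : mul e e = e) {z a c : A}
    (h₁ : le (mul a e) c) (h₂ : le (mul a (imp e z)) c) : le a c := by
  rw [hA.mul_comm, hA.residuation] at h₁ h₂
  -- Both `e` and `e → z` lie below `d = a → c`; the claim is `d = 1`.
  generalize hd : imp a c = d at h₁ h₂
  have hw : le (imp (imp e z) e) e := by
    rw [← hA.imp_eq_one_iff, hT, hA.imp_idem_imp he, hA.imp_eq_one_iff]
    exact hA.le_refl _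
  have hde : imp (imp d e) e = one A :=
    hA.imp_eq_one_iff.2 (hA.le_trans (hA.imp_le_imp_right h₂ e) hw)
  rwa [hT, hA.imp_eq_one_iff.2 h₁, hA.one_imp, ← hd, hA.imp_eq_one_iff] at hde

theorem imp_inf (hA : IsCIRL A) (e x y : A) : imp e (inf x y) = inf (imp e x) (imp e y) := by
  refine hA.le_antisymm (hA.le_inf (hA.imp_le_imp_left (hA.inf_le_left x y) e)
    (hA.imp_le_imp_left (hA.inf_le_right x y) e)) ((hA.residuation _ _ _).1 (hA.le_inf ?_ ?_))
  · exact (hA.residuation _ _ _).2 (hA.inf_le_left _ _)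
  · exact (hA.residuation _ _ _).2 (hA.inf_le_right _ _)

theorem idem_imp_imp (hA : IsCIRL A) {e : A} (he : mul e e = e) (x y : A) :
    imp e (imp x y) = imp (imp e x) (imp e y) := by
  refine hA.le_antisymm ?_ ?_
  · rw [← hA.residuation, ← hA.residuation, hA.mul_assoc]
    -- As `e = e · e`, one factor `e` serves `e → (x → y)` and the other serves `e → x`.
    have h : mul (imp e (imp x y)) (mul (imp e x) e) =
        mul (mul (imp e (imp x y)) e) (mul (imp e x) e) := by
      rw [hA.mul_assoc, hA.mul_comm e, hA.mul_assoc (imp e x), he]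
    rw [h]
    exact hA.le_trans (hA.mul_le_mul_right (hA.imp_mul_le _ _) _)
      (hA.le_trans (hA.mul_le_mul_left (hA.imp_mul_le _ _) _) (hA.imp_mul_le _ _))
  · rw [← hA.residuation, ← hA.residuation, hA.mul_assoc, hA.mul_comm e, ← hA.mul_assoc]
    exact hA.le_trans (hA.mul_le_mul_right (hA.le_trans
      (hA.mul_le_mul_left (hA.le_imp e x) _) (hA.imp_mul_le _ _)) _) (hA.imp_mul_le _ _)

theorem idem_imp_sup (hA : IsCIRL A) (hT : ∀ x y : A, imp (imp x y) y = imp (imp y x) x) {e : A}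
    (he : mul e e = e) (x y : A) : imp e (sup x y) = sup (imp e x) (imp e y) := by
  refine hA.le_antisymm (hA.le_of_mul_idem_le hT he (z := x) ?_ ?_)
    (hA.sup_le (hA.imp_le_imp_left (hA.le_sup_left _ _) _)
      (hA.imp_le_imp_left (hA.le_sup_right _ _) _))
  · exact hA.le_trans (hA.imp_mul_le _ _) (hA.sup_le
      (hA.le_trans (hA.le_imp e x) (hA.le_sup_left _ _))
      (hA.le_trans (hA.le_imp e y) (hA.le_sup_right _ _)))
  · exact hA.le_trans (hA.mul_le_right _ _) (hA.le_sup_left _ _)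

theorem idem_imp_mul (hA : IsCIRL A) (hT : ∀ x y : A, imp (imp x y) y = imp (imp y x) x) {e : A}
    (he : mul e e = e) (x y : A) : imp e (mul x y) = mul (imp e x) (imp e y) := by
  refine hA.le_antisymm (hA.le_of_mul_idem_le hT he (z := mul x y) ?_ ?_) ?_
  · exact hA.le_trans (hA.imp_mul_le _ _) (hA.le_trans (hA.mul_le_mul_right (hA.le_imp e x) _)
      (hA.mul_le_mul_left (hA.le_imp e y) _))
  · exact hA.le_trans (hA.mul_le_mul_right (hA.imp_le_imp_left (hA.mul_le_left x y) e) _)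
      (hA.mul_le_mul_left (hA.imp_le_imp_left (hA.mul_le_right x y) e) _)
  · rw [← hA.residuation]
    -- As `e = e · e`, each of the two factors gets its own `e`.
    have h : mul (mul (imp e x) (imp e y)) e = mul (mul (imp e x) e) (mul (imp e y) e) := by
      rw [hA.mul_assoc (imp e x) e, hA.mul_comm e, hA.mul_assoc (imp e y) e, he, hA.mul_assoc]
    rw [h]
    exact hA.le_trans (hA.mul_le_mul_right (hA.imp_mul_le _ _) _)
      (hA.mul_le_mul_left (hA.imp_mul_le _ _) _)

/-- For an idempotent `e` of a commutative integral residuated lattice satisfying Tanaka's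
equation, the endomorphism `x ↦ (e → x)`. -/
def impHom (hA : IsCIRL A) (hT : ∀ x y : A, imp (imp x y) y = imp (imp y x) x) {e : A}
    (he : mul e e = e) : A →[lang] A where
  toFun := imp e
  map_fun' f x := by
    have two : ∀ x : Fin 2 → A, x = ![x 0, x 1] := fun x => by
      ext i; fin_cases i <;> rfl
    cases f with
    | one =>
      rw [Subsingleton.elim (imp e ∘ x) ![], Subsingleton.elim x ![] ]
      exact hA.imp_eq_one_iff.2 (hA.le_one e)
    | sup => rw [two (imp e ∘ x), two x]; exact hA.idem_imp_sup hT he _ _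
    | inf => rw [two (imp e ∘ x), two x]; exact hA.imp_inf e _ _
    | mul => rw [two (imp e ∘ x), two x]; exact hA.idem_imp_mul hT he _ _
    | imp => rw [two (imp e ∘ x), two x]; exact hA.idem_imp_imp he _ _
  map_rel' r := r.elim

end IsCIRL

/-! ### Homomorphic images of finite Wajsberg hoops -/

section Image

variable {A B : Type u} [lang.Structure A] [lang.Structure B]

/-- The kernel filter of a homomorphism on a finite algebra is principal, generated by an
idempotent. -/
theorem exists_idem_generator [Finite A] (hA : IsCIRL A) (f : A →[lang] B) :
    ∃ e : A, f e = one B ∧ mul e e = e ∧ ∀ x, f x = one B → le e x := by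
  have hone : mul (one B) (one B) = one B := by
    rw [← map_one f, ← map_mul, hA.one_mul]
  have hmul : ∀ x y, f x = one B → f y = one B → f (mul x y) = one B := fun x y hx hy => by
    rw [map_mul, hx, hy, hone]
  have key : ∀ s : Set A, s.Finite → ∃ e, f e = one B ∧ ∀ x ∈ s, f x = one B → le e x := by
    intro s hs
    induction s, hs using Set.Finite.induction_on with
    | empty => exact ⟨one A, map_one f, by simp⟩
    | @insert a s _ _ ih =>
      obtain ⟨e, he, hle⟩ := ih
      by_cases ha : f a = one B
      · refine ⟨mul a e, hmul _ _ ha he, ?_⟩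
        rintro x (rfl | hx) hfx
        · exact hA.mul_le_left _ _
        · exact hA.le_trans (hA.mul_le_right _ _) (hle x hx hfx)
      · refine ⟨e, he, ?_⟩
        rintro x (rfl | hx) hfx
        · exact absurd hfx ha
        · exact hle x hx hfx
  obtain ⟨e, he, hle⟩ := key Set.univ Set.finite_univ
  exact ⟨e, he, hA.le_antisymm (hA.mul_le_left _ _) (hle _ trivial (hmul e e he he)),
    fun x => hle x trivial⟩

theorem exists_embedding_of_surjective [Finite A] (hA : IsWajsbergHoop A) (f : A →[lang] B)
    (hf : Function.Surjective f) : Nonempty (B ↪[lang] A) := by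
  have hC := hA.isCIRL
  obtain ⟨e, he, hee, hle⟩ := exists_idem_generator hC f
  have hfe : ∀ x, f (imp e x) = f x := fun x => by
    rw [map_imp, he, ← map_one f, ← map_imp, hC.one_imp]
  have hmono : ∀ x y, f x = f y → le (imp e x) (imp e y) := fun x y hxy => by
    have h : le e (imp x y) := hle _ <| by
      rw [map_imp, hxy, ← map_imp, hC.imp_eq_one_iff.2 (hC.le_refl y), map_one]
    rw [← hC.imp_idem_imp hee y]
    rw [← hC.residuation, hC.mul_comm] at h
    exact (hC.residuation _ _ _).1 (hC.le_trans (hC.imp_mul_le e x)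
      ((hC.residuation _ _ _).1 h))
  let φ := hC.impHom hA.tanaka hee
  have hφ : ∀ x y, f x = f y → φ x = φ y := fun x y hxy =>
    hC.le_antisymm (hmono x y hxy) (hmono y x hxy.symm)
  have hs := Function.surjInv_eq hf
  refine ⟨⟨⟨fun b => φ (Function.surjInv hf b), fun b c h => ?_⟩, fun g x => ?_,
    fun r => r.elim⟩⟩
  · have h' := congrArg f h
    change f (imp e _) = f (imp e _) at h'
    rwa [hfe, hfe, hs, hs] at h'
  · have h : f (Structure.funMap g fun i => Function.surjInv hf (x i)) = Structure.funMap g x :=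
      (f.map_fun g _).trans (congrArg _ (funext fun i => hs (x i)))
    exact (hφ _ _ ((hs _).trans h.symm)).trans (φ.map_fun g _)

end Image

end Hoop

/-! ### Locally finite quasivarieties of Wajsberg hoops -/

namespace UnivAlg

theorem IsLocallyFinite.isVariety {Q : Set (Bundled.{u} Hoop.lang.Structure)}
    (hQ : IsQuasivariety Q) (hWH : Q ⊆ Hoop.WH) (hfin : IsLocallyFinite Q) : IsVariety Q where
  homImages := by
    rintro B ⟨A, hA, f, hf⟩
    have : Hoop.lang.IsAlgebraic := fun _ => inferInstanceAs (IsEmpty Empty)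
    refine hQ.mem_of_forall_fg Hoop.Op.one fun T hT => ?_
    obtain ⟨S, hS, g, hg⟩ := exists_fg_surjective f hf hT
    have hSQ := hQ.subalgebras A hA S
    have : Finite (subalgebra A S) := hfin A hA S hS
    obtain ⟨j⟩ := Hoop.exists_embedding_of_surjective (hWH hSQ) g hg
    exact hQ.mem_of_embedding hSQ j
  subalgebras := hQ.subalgebras
  products := hQ.products

end UnivAlg

theorem mainTheorem4 (Q : Set (CategoryTheory.Bundled.{u} Hoop.lang.Structure))
    (hQ : UnivAlg.IsQuasivariety Q) (hWH : Q ⊆ Hoop.WH) (hfin : UnivAlg.IsLocallyFinite Q) :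
    UnivAlg.IsVariety Q ∧ UnivAlg.IsPrimitive Q := by
  refine ⟨hfin.isVariety hQ hWH, hQ, fun Q' hQ' hsub => ?_⟩
  have hV : UnivAlg.IsVariety Q' :=
    UnivAlg.IsLocallyFinite.isVariety hQ' (hsub.trans hWH) fun A hA => hfin A (hsub hA)
  exact Set.Subset.antisymm
    (fun A hA => ⟨⟨A, hA, FirstOrder.Language.Hom.id _ _, Function.surjective_id⟩, hsub hA⟩)
    fun A hA => hV.homImages hA.1
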